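/- Let $R$ be a commutative Noetherian ring, $A$ a ring (associative with unit, not necessarily commutative), and $\varphi\colon R\to A$ a ring homomorphism whose image lies in the center of $A$. Assume that $\varphi$ is a Frobenius extension, i.e. $A$ is finitely generated projective as a left $R$-module (via $r\cdot a=\varphi(r)a$) and there is an isomorphism $A\cong \operatorname{Hom}_R(A,R)$ of $A$-$R$-bimodules, where $(b\cdot f\cdot r)(x)=f(xb)\,r$ for $b,x\in A$, $r\in R$, $f\in\operatorname{Hom}_R(A,R)$. Assume also that $A$ is faithfully flat as a right $R$-module (via $a\cdot r=a\varphi(r)$). Then for every integer $k>0$, the ring $R$ is $k$-Gorenstein if and only if the ring $A$ is $k$-Gorenstein. Here a (two-sided Noetherian) ring $S$ is called $k$-Gorenstein if, in a minimal injective resolution $$0\to S\to I^0\to I^1\to\cdots\to I^i\to\cdots$$ of $S$ as a left $S$-module, one has $\operatorname{fd}_S(I^i)\le i$ for all $0\le i\le k-1$, where $\operatorname{fd}_S$ denotes flat dimension. (The ring $A$ is automatically two-sided Noetherian, being a finitely generated module over the central image of $R$.) -/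

import Mathlib

open CategoryTheory
open scoped TensorProduct

universe u v w

/-! ### Tensor products, flatness and flat dimension over a ring that need not be commutative

Modules are left modules. A right `A`-module is a module over `Aᵐᵒᵖ`. -/

/-- The relations `(n a) ⊗ m - n ⊗ (a m)` that cut the tensor product of a right `A`-module `N` and
a left `A`-module `M` out of their tensor product over `ℤ`. -/
def balancedRelations (A : Type u) [Ring A] (N : Type v) [AddCommGroup N] [Module Aᵐᵒᵖ N]
    (M : Type w) [AddCommGroup M] [Module A M] : AddSubgroup (N ⊗[ℤ] M) :=
  AddSubgroup.closure {z | ∃ (n : N) (a : A) (m : M),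
    z = (MulOpposite.op a • n) ⊗ₜ[ℤ] m - n ⊗ₜ[ℤ] (a • m)}

/-- The tensor product `N ⊗_A M` of a right `A`-module `N` and a left `A`-module `M`. -/
abbrev BalancedTensor (A : Type u) [Ring A] (N : Type v) [AddCommGroup N] [Module Aᵐᵒᵖ N]
    (M : Type w) [AddCommGroup M] [Module A M] : Type (max v w) :=
  (N ⊗[ℤ] M) ⧸ balancedRelations A N M

/-- The map `f ⊗_A M : N ⊗_A M → N' ⊗_A M` induced by a map `f : N → N'` of right `A`-modules. -/
def BalancedTensor.map {A : Type u} [Ring A] {N N' : Type v} [AddCommGroup N] [Module Aᵐᵒᵖ N]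
    [AddCommGroup N'] [Module Aᵐᵒᵖ N'] (f : N →ₗ[Aᵐᵒᵖ] N')
    (M : Type w) [AddCommGroup M] [Module A M] :
    BalancedTensor A N M →+ BalancedTensor A N' M :=
  QuotientAddGroup.map (balancedRelations A N M) (balancedRelations A N' M)
    (LinearMap.rTensor M f.toAddMonoidHom.toIntLinearMap).toAddMonoidHom (by
      rw [balancedRelations, AddSubgroup.closure_le]
      rintro _ ⟨n, a, m, rfl⟩
      exact AddSubgroup.subset_closure ⟨f n, a, m, by simp⟩)

/-- The left `A`-module `M` is flat: the functor `- ⊗_A M` preserves injectivity of maps of right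
`A`-modules. -/
def IsFlatModule (A : Type u) [Ring A] (M : Type v) [AddCommGroup M] [Module A M] : Prop :=
  ∀ (N N' : Type u) [AddCommGroup N] [Module Aᵐᵒᵖ N] [AddCommGroup N'] [Module Aᵐᵒᵖ N']
    (f : N →ₗ[Aᵐᵒᵖ] N'), Function.Injective f → Function.Injective (BalancedTensor.map f M)

/-- `fd_A(M) ≤ n`: the left `A`-module `M` has a flat resolution
`0 → F_n → ⋯ → F_1 → F_0 → M → 0` of length at most `n`, expressed by recursion on `n`
through the kernel of `F_0 → M`. -/
def FlatDimensionLE (A : Type u) [Ring A] :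
    ℕ → ∀ (M : Type u) [AddCommGroup M] [Module A M], Prop
  | 0, M, _, _ => IsFlatModule A M
  | n + 1, M, _, _ => ∃ (F : Type u) (_ : AddCommGroup F) (_ : Module A F) (p : F →ₗ[A] M),
      IsFlatModule A F ∧ Function.Surjective p ∧ FlatDimensionLE A n (LinearMap.ker p)

/-! ### Minimal injective resolutions and `k`-Gorenstein rings -/

/-- `M` is an essential extension of its submodule `L`. -/
def IsEssentialSubmodule {A : Type u} [Ring A] {M : Type v} [AddCommGroup M] [Module A M]
    (L : Submodule A M) : Prop :=
  ∀ N : Submodule A M, L ⊓ N = ⊥ → N = ⊥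

/-- An injective resolution `0 → M → I⁰ → I¹ → ⋯` is minimal if every `Iⁱ` is an injective hull of
the kernel of `Iⁱ → Iⁱ⁺¹` (which is the image of `M` for `i = 0` and that of `Iⁱ⁻¹` for `i > 0`). -/
def IsMinimalInjectiveResolution {A : Type u} [Ring A] {M : ModuleCat.{u} A}
    (I : InjectiveResolution M) : Prop :=
  ∀ i : ℕ, IsEssentialSubmodule (LinearMap.ker (I.cocomplex.d i (i + 1)).hom)

/-- The ring `A` is `k`-Gorenstein: in the minimal injective resolution of the left module `A`
(which exists and is unique up to isomorphism) one has `fd_A(Iⁱ) ≤ i` for `0 ≤ i ≤ k - 1`. -/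
def IsKGorenstein (A : Type u) [Ring A] (k : ℕ) : Prop :=
  ∃ I : InjectiveResolution (ModuleCat.of A A), IsMinimalInjectiveResolution I ∧
    ∀ i : ℕ, i < k → FlatDimensionLE A i (I.cocomplex.X i)

/-! ### Ring extensions -/

/-- `A` as a left `R`-module along `φ : R → A`, with `r • a = φ(r) a`. -/
abbrev leftModuleAlong {R : Type u} {A : Type v} [Ring R] [Ring A] (φ : R →+* A) : Module R A :=
  Module.compHom A φ

/-- `A` as a right `R`-module along `φ : R → A`, with `a • r = a φ(r)`. -/
abbrev rightModuleAlong {R : Type u} {A : Type v} [Ring R] [Ring A] (φ : R →+* A) :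
    Module Rᵐᵒᵖ A :=
  Module.compHom A φ.op

/-- A ring homomorphism `φ : R → A` is a Frobenius extension if `A` is finitely generated projective
as a left `R`-module and `A ≅ Hom_R(A, R)` as `A`-`R`-bimodules; the bimodule structure on
`Hom_R(A, R)` is `(b f r)(x) = f(x b) r`. -/
structure IsFrobeniusExtension {R : Type u} {A : Type v} [Ring R] [Ring A] (φ : R →+* A) :
    Prop where
  finite : letI := leftModuleAlong φ; Module.Finite R A
  projective : letI := leftModuleAlong φ; Module.Projective R A
  exists_equiv : letI := leftModuleAlong φ
    ∃ e : A ≃+ (A →ₗ[R] R),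
      (∀ b a x : A, e (b * a) x = e a (x * b)) ∧
      (∀ (a : A) (r : R) (x : A), e (a * φ r) x = e a x * r)

/-! Write M⁺ for the character module of M. Lambek's criterion and dimension shifting
(`flatDimensionLE_iff`) identify fd M with the injective dimension of M⁺, so bounds on fd pass to
retracts. A minimal injective resolution is a degreewise retract of any injective resolution, so it
suffices to bound fd along some injective resolution of a module having the ring as a retract
(`isKGorenstein_of_exact`).

From R to A: tensor a resolution of R with A. Flatness keeps it exact and does not raise fd; the
Frobenius form gives A ⊗ Q ≅ Hom_R(A, Q), which is injective when Q is. From A to R: restrict a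
resolution of A to R. Since A is R-flat, injectivity and fd bounds survive, and faithful flatness
makes R a retract of A as an R-module. -/

/-! ### Character modules and their exactness -/

/-- The character module `Hom_ℤ(M, ℚ/ℤ)` of a left module, regarded as a right module. -/
def RightCharacterModule (M : Type v) [AddCommGroup M] : Type v := M →+ AddCircle (1 : ℚ)

namespace RightCharacterModule

section

variable {M : Type v} [AddCommGroup M]

instance : AddCommGroup (RightCharacterModule M) :=
  inferInstanceAs (AddCommGroup (M →+ AddCircle (1 : ℚ)))

instance : FunLike (RightCharacterModule M) M (AddCircle (1 : ℚ)) :=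
  inferInstanceAs (FunLike (M →+ AddCircle (1 : ℚ)) M (AddCircle (1 : ℚ)))

instance : AddMonoidHomClass (RightCharacterModule M) M (AddCircle (1 : ℚ)) :=
  inferInstanceAs (AddMonoidHomClass (M →+ AddCircle (1 : ℚ)) M (AddCircle (1 : ℚ)))

/-- A character from an additive map. -/
def of (c : M →+ AddCircle (1 : ℚ)) : RightCharacterModule M := c

@[simp] lemma of_apply (c : M →+ AddCircle (1 : ℚ)) (m : M) : of c m = c m := rfl

@[ext] lemma ext {c c' : RightCharacterModule M} (h : ∀ m, c m = c' m) : c = c' :=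
  DFunLike.ext _ _ h

@[simp] lemma add_apply (c c' : RightCharacterModule M) (m : M) : (c + c') m = c m + c' m := rfl

@[simp] lemma zero_apply (m : M) : (0 : RightCharacterModule M) m = 0 := rfl

instance {A : Type u} [Ring A] [Module A M] : Module Aᵐᵒᵖ (RightCharacterModule M) where
  smul a c := of ((c : M →+ AddCircle (1 : ℚ)).comp (DistribSMul.toAddMonoidHom M a.unop))
  one_smul c := by
    ext m
    exact congrArg c (one_smul A m)
  mul_smul a b c := by
    ext m
    exact congrArg c (mul_smul b.unop a.unop m)
  smul_zero a := rfl
  smul_add a c c' := rfl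
  add_smul a b c := by
    ext m
    exact (congrArg c (add_smul a.unop b.unop m)).trans (map_add c _ _)
  zero_smul c := by
    ext m
    exact (congrArg c (zero_smul A m)).trans (map_zero c)

@[simp] lemma smul_apply {A : Type u} [Ring A] [Module A M] (a : Aᵐᵒᵖ)
    (c : RightCharacterModule M) (m : M) : (a • c) m = c (a.unop • m) := rfl

end

section

variable {A : Type u} [Ring A] {M : Type v} [AddCommGroup M] [Module A M]
  {N : Type w} [AddCommGroup N] [Module A N]

/-- The right module map between character modules dual to a left module map. -/
def dual (f : M →ₗ[A] N) : RightCharacterModule N →ₗ[Aᵐᵒᵖ] RightCharacterModule M where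
  toFun c := of ((c : N →+ AddCircle (1 : ℚ)).comp f.toAddMonoidHom)
  map_add' _ _ := rfl
  map_smul' a c := by
    ext m
    exact congrArg c (f.map_smul a.unop m).symm

@[simp] lemma dual_apply (f : M →ₗ[A] N) (c : RightCharacterModule N) (m : M) :
    dual f c m = c (f m) := rfl

lemma exists_extension {X : Type v} {Y : Type w} [AddCommGroup X] [AddCommGroup Y] (f : X →+ Y)
    (hf : Function.Injective f) (c : X →+ AddCircle (1 : ℚ)) :
    ∃ c' : Y →+ AddCircle (1 : ℚ), ∀ x, c' (f x) = c x := by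
  obtain ⟨c', hc'⟩ := CharacterModule.dual_surjective_of_injective f.toIntLinearMap hf c
  exact ⟨c', fun x ↦ DFunLike.congr_fun hc' x⟩

lemma dual_surjective {f : M →ₗ[A] N} (hf : Function.Injective f) :
    Function.Surjective (dual f) := fun c ↦ by
  obtain ⟨c', h⟩ := exists_extension f.toAddMonoidHom hf c
  exact ⟨c', ext h⟩

lemma dual_injective {f : M →ₗ[A] N} (hf : Function.Surjective f) :
    Function.Injective (dual f) := fun c c' h ↦ by
  ext n
  obtain ⟨m, rfl⟩ := hf n
  exact DFunLike.congr_fun h m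

lemma dual_exact {P : Type*} [AddCommGroup P] [Module A P] {f : M →ₗ[A] N} {g : N →ₗ[A] P}
    (h : Function.Exact f g) (hg : Function.Surjective g) :
    Function.Exact (dual g) (dual f) := fun c ↦ by
  refine ⟨fun hc ↦ ?_, ?_⟩
  · have hker : g.toAddMonoidHom.ker ≤ AddMonoidHom.ker (c : N →+ AddCircle (1 : ℚ)) := by
      intro n hn
      obtain ⟨m, rfl⟩ := (h n).1 hn
      exact DFunLike.congr_fun hc m
    refine ⟨of (g.toAddMonoidHom.liftOfRightInverse _ (Function.rightInverse_surjInv hg)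
      ⟨c, hker⟩), ext fun n ↦ ?_⟩
    exact AddMonoidHom.liftOfRightInverse_comp_apply _ _ (Function.rightInverse_surjInv hg)
      ⟨c, hker⟩ n
  · rintro ⟨d, rfl⟩
    ext m
    simp [h.apply_apply_eq_zero m]

end

end RightCharacterModule

/-! ### Tensor-hom adjunction and Lambek's criterion -/

namespace BalancedTensor

variable {A : Type u} [Ring A] {N N' : Type v} [AddCommGroup N] [Module Aᵐᵒᵖ N]
  [AddCommGroup N'] [Module Aᵐᵒᵖ N'] {M : Type w} [AddCommGroup M] [Module A M]

/-- The pure tensor `n ⊗ m` in `N ⊗_A M`. -/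
def tmul (n : N) (m : M) : BalancedTensor A N M := QuotientAddGroup.mk (n ⊗ₜ[ℤ] m)

@[simp] lemma map_tmul (f : N →ₗ[Aᵐᵒᵖ] N') (n : N) (m : M) :
    map f M (tmul n m) = tmul (f n) m := rfl

lemma smul_tmul (a : Aᵐᵒᵖ) (n : N) (m : M) :
    (tmul (a • n) m : BalancedTensor A N M) = tmul n (a.unop • m) := by
  refine (QuotientAddGroup.eq_iff_sub_mem).2 (AddSubgroup.subset_closure ⟨n, a.unop, m, rfl⟩)

/-- A character of `N ⊗_A M` gives a right module map from `N` to the character module of `M`. -/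
def curry (c : BalancedTensor A N M →+ AddCircle (1 : ℚ)) :
    N →ₗ[Aᵐᵒᵖ] RightCharacterModule M where
  toFun n := .of
    { toFun := fun m ↦ c (tmul n m)
      map_zero' := by simp [tmul]
      map_add' := fun m m' ↦ by simp [tmul, TensorProduct.tmul_add] }
  map_add' n n' := by
    ext m
    simp [tmul, TensorProduct.add_tmul]
  map_smul' a n := by
    ext m
    exact congrArg c (smul_tmul a n m)

@[simp] lemma curry_apply (c : BalancedTensor A N M →+ AddCircle (1 : ℚ)) (n : N) (m : M) :
    curry c n m = c (tmul n m) := rfl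

/-- A right module map from `N` to the character module of `M` gives a character of `N ⊗_A M`. -/
def uncurry (g : N →ₗ[Aᵐᵒᵖ] RightCharacterModule M) :
    BalancedTensor A N M →+ AddCircle (1 : ℚ) :=
  QuotientAddGroup.lift _
    (TensorProduct.liftAddHom (R := ℤ)
      { toFun := fun n ↦ ((g n : RightCharacterModule M) : M →+ AddCircle (1 : ℚ))
        map_zero' := g.map_zero
        map_add' := g.map_add }
      (fun r n m ↦ by
        change g (r • n) m = g n (r • m)
        rw [map_zsmul, map_zsmul]
        exact AddMonoidHom.coe_smul r (g n : M →+ AddCircle (1 : ℚ)) ▸ rfl))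
    (by
      rw [balancedRelations, AddSubgroup.closure_le]
      rintro _ ⟨n, a, m, rfl⟩
      rw [SetLike.mem_coe, AddMonoidHom.mem_ker, map_sub, sub_eq_zero]
      exact DFunLike.congr_fun (g.map_smul (MulOpposite.op a) n) m)

@[simp] lemma uncurry_tmul (g : N →ₗ[Aᵐᵒᵖ] RightCharacterModule M) (n : N) (m : M) :
    uncurry g (tmul n m) = g n m := rfl

lemma addHom_ext {P : Type*} [AddCommGroup P] {f g : BalancedTensor A N M →+ P}
    (h : ∀ n m, f (tmul n m) = g (tmul n m)) : f = g := by
  refine QuotientAddGroup.addMonoidHom_ext _ (AddMonoidHom.ext fun z ↦ ?_)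
  induction z with
  | zero => simp
  | tmul n m => exact h n m
  | add x y hx hy => rw [map_add, map_add, hx, hy]

end BalancedTensor

open RightCharacterModule in
/-- Lambek's criterion. -/
theorem isFlatModule_iff_injective {A : Type u} [Ring A] {M : Type u} [AddCommGroup M]
    [Module A M] : IsFlatModule A M ↔ Module.Injective Aᵐᵒᵖ (RightCharacterModule M) := by
  refine ⟨fun h ↦ ⟨fun N N' _ _ _ _ f hf g ↦ ?_⟩, fun h N N' _ _ _ _ f hf ↦ ?_⟩
  · obtain ⟨c, hc⟩ := exists_extension (BalancedTensor.map f M) (h N N' f hf)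
      (BalancedTensor.uncurry g)
    exact ⟨BalancedTensor.curry c, fun n ↦ RightCharacterModule.ext fun m ↦ hc (.tmul n m)⟩
  · refine (injective_iff_map_eq_zero _).2 fun z hz ↦ ?_
    by_contra hz0
    obtain ⟨c, hc⟩ := CharacterModule.exists_character_apply_ne_zero_of_ne_zero hz0
    obtain ⟨h', hh'⟩ := h.out f hf (BalancedTensor.curry (c : _ →+ AddCircle (1 : ℚ)))
    refine hc ?_
    have : (BalancedTensor.uncurry h').comp (BalancedTensor.map f M) = c :=
      BalancedTensor.addHom_ext fun n m ↦ DFunLike.congr_fun (hh' n) m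
    calc c z = BalancedTensor.uncurry h' (BalancedTensor.map f M z) :=
          (DFunLike.congr_fun this z).symm
      _ = 0 := by rw [hz, map_zero]

lemma rightCharacterModule_finsupp_ext {A : Type u} [AddCommGroup A] {ι : Type u}
    {c d : RightCharacterModule (ι →₀ A)}
    (h : ∀ i b, c (Finsupp.single i b) = d (Finsupp.single i b)) : c = d :=
  Finsupp.addHom_ext (f := (c : _ →+ AddCircle (1 : ℚ))) (g := (d : _ →+ AddCircle (1 : ℚ))) h

/-- The character module of a free module is injective. -/
theorem injective_rightCharacterModule_finsupp (A : Type u) [Ring A] (ι : Type u) :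
    Module.Injective Aᵐᵒᵖ (RightCharacterModule (ι →₀ A)) := by
  refine ⟨fun N N' _ _ _ _ f hf g ↦ ?_⟩
  -- A right module map into the dual of a free module is determined by the characters it gives at
  -- the basis vectors, so only additive extensions are needed.
  have (i : ι) : ∃ c : N' →+ AddCircle (1 : ℚ), ∀ n, c (f n) = g n (Finsupp.single i 1) :=
    RightCharacterModule.exists_extension f.toAddMonoidHom hf
      { toFun := fun n ↦ g n (Finsupp.single i 1)
        map_zero' := by simp
        map_add' := by simp }
  choose c hc using this
  refine ⟨{ toFun := fun n' ↦ .of (Finsupp.liftAddHom fun i ↦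
              { toFun := fun a ↦ c i (MulOpposite.op a • n')
                map_zero' := by simp
                map_add' := fun a b ↦ by simp [add_smul] })
            map_add' := fun x y ↦ ?_
            map_smul' := fun a x ↦ ?_ }, fun n ↦ ?_⟩
  · refine rightCharacterModule_finsupp_ext fun i b ↦ ?_
    simp
  · refine rightCharacterModule_finsupp_ext fun i b ↦ ?_
    rw [RightCharacterModule.smul_apply, Finsupp.smul_single]
    simp [smul_smul, -Finsupp.single_mul]
  · refine rightCharacterModule_finsupp_ext fun i b ↦ ?_
    calc _ = c i (MulOpposite.op b • f n) := by simp
      _ = g n (MulOpposite.unop (MulOpposite.op b) • Finsupp.single i 1) := by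
        rw [← map_smul f, hc, map_smul, RightCharacterModule.smul_apply]
      _ = _ := by rw [Finsupp.smul_single, MulOpposite.unop_op, smul_eq_mul, mul_one]

/-! ### Flat dimension as injective dimension of the character module -/

section

variable {A : Type u} [Ring A] {M F : Type u} [AddCommGroup M] [Module A M] [AddCommGroup F]
  [Module A F]

/-- The short exact sequence of character modules `0 → M⁺ → F⁺ → (ker p)⁺ → 0`. -/
def RightCharacterModule.shortComplex (p : F →ₗ[A] M) : ShortComplex (ModuleCat.{u} Aᵐᵒᵖ) :=
  ShortComplex.mk (ModuleCat.ofHom (dual p)) (ModuleCat.ofHom (dual (LinearMap.ker p).subtype)) (by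
    refine ModuleCat.hom_ext (LinearMap.ext fun c ↦
      RightCharacterModule.ext (M := LinearMap.ker p) fun m ↦ ?_)
    simp)

lemma RightCharacterModule.shortExact (p : F →ₗ[A] M) (hp : Function.Surjective p) :
    (shortComplex p).ShortExact where
  exact := (ShortComplex.ShortExact.moduleCat_exact_iff_function_exact _).2
    (dual_exact (LinearMap.exact_subtype_ker_map p) hp)
  mono_f := (ModuleCat.mono_iff_injective _).2 (dual_injective hp)
  epi_g := (ModuleCat.epi_iff_surjective _).2 (dual_surjective (Submodule.subtype_injective _))

/-- Dualizing 0 → ker p → F → M → 0 with F flat puts an injective in the middle, so the dimension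
shifts by one; `LT (n + 1)` means at most n. For the converse, F can be free. -/
theorem flatDimensionLE_iff (n : ℕ) : ∀ (M : Type u) [AddCommGroup M] [Module A M],
    FlatDimensionLE A n M ↔
      HasInjectiveDimensionLT (ModuleCat.of Aᵐᵒᵖ (RightCharacterModule M)) (n + 1) := by
  induction n with
  | zero =>
    intro M _ _
    rw [FlatDimensionLE, isFlatModule_iff_injective, Module.injective_iff_injective_object,
      injective_iff_hasInjectiveDimensionLT_one]
  | succ n ih =>
    intro M _ _
    rw [FlatDimensionLE]
    constructor
    · rintro ⟨F, _, _, p, hF, hp, hK⟩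
      rw [isFlatModule_iff_injective, Module.injective_iff_injective_object] at hF
      exact ((RightCharacterModule.shortExact p hp).hasInjectiveDimensionLT_X₃_iff n hF).1
        ((ih _).1 hK)
    · intro h
      have hF := injective_rightCharacterModule_finsupp A M
      have hp : Function.Surjective (Finsupp.linearCombination A (id : M → M)) :=
        Finsupp.linearCombination_id_surjective A M
      refine ⟨M →₀ A, inferInstance, inferInstance, Finsupp.linearCombination A id,
        isFlatModule_iff_injective.2 hF, hp, (ih _).2 ?_⟩
      rw [Module.injective_iff_injective_object] at hF
      exact ((RightCharacterModule.shortExact _ hp).hasInjectiveDimensionLT_X₃_iff n hF).2 h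

theorem FlatDimensionLE.of_retract {n : ℕ} (h : FlatDimensionLE A n M) (i : F →ₗ[A] M)
    (r : M →ₗ[A] F) (hri : ∀ x, r (i x) = x) : FlatDimensionLE A n F := by
  rw [flatDimensionLE_iff] at h ⊢
  refine Retract.hasInjectiveDimensionLT (Y := ModuleCat.of Aᵐᵒᵖ (RightCharacterModule M))
    ⟨ModuleCat.ofHom (RightCharacterModule.dual r), ModuleCat.ofHom (RightCharacterModule.dual i), ?_⟩ _
  refine ModuleCat.hom_ext (LinearMap.ext fun c ↦
    RightCharacterModule.ext (M := F) fun x ↦ ?_)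
  simp [hri]

theorem FlatDimensionLE.of_linearEquiv {n : ℕ} (h : FlatDimensionLE A n M) (e : F ≃ₗ[A] M) :
    FlatDimensionLE A n F :=
  h.of_retract e.toLinearMap e.symm.toLinearMap e.symm_apply_apply

end

/-! ### Injective hulls -/

section InjectiveHull

lemma Submodule.exists_maximal_disjoint {A : Type u} [Ring A] {Q : Type v} [AddCommGroup Q]
    [Module A Q] {X Y : Submodule A Q} (h : Disjoint Y X) :
    ∃ Z, X ≤ Z ∧ Disjoint Y Z ∧ ∀ W, Z ≤ W → Disjoint Y W → W = Z := by
  obtain ⟨Z, hXZ, hZ⟩ := zorn_le_nonempty₀ {Z : Submodule A Q | Disjoint Y Z}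
    (fun c hc hchain Z hZ ↦ ⟨sSup c, hchain.directedOn.disjoint_sSup_right.2 fun W hW ↦ hc hW,
      fun W hW ↦ le_sSup hW⟩) X h
  exact ⟨Z, hXZ, hZ.prop, fun W hW hd ↦ (hZ.eq_of_le hd hW).symm⟩

variable {A : Type u} [Ring A] {Q M E : Type u} [AddCommGroup Q] [Module A Q]
  [AddCommGroup M] [Module A M] [AddCommGroup E] [Module A E]

lemma Module.Injective.of_retract [Module.Injective A Q] (i : E →ₗ[A] Q) (r : Q →ₗ[A] E)
    (hri : ∀ x, r (i x) = x) : Module.Injective A E where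
  out X Y _ _ _ _ f hf g := by
    obtain ⟨h, hh⟩ := Module.Injective.out f hf (i ∘ₗ g)
    exact ⟨r ∘ₗ h, fun x ↦ by simp [hh, hri]⟩

lemma IsEssentialSubmodule.injective_of_comp {f : M →ₗ[A] E}
    (hf : IsEssentialSubmodule (LinearMap.range f)) {g : E →ₗ[A] Q}
    (hg : Function.Injective (g ∘ₗ f)) : Function.Injective g := by
  rw [← LinearMap.ker_eq_bot]
  refine hf _ ((Submodule.eq_bot_iff _).2 ?_)
  rintro _ ⟨⟨m, rfl⟩, hm⟩
  rw [hg (hm.trans (map_zero (g ∘ₗ f)).symm), map_zero]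

/-- Every submodule of an injective module has an injective hull inside it. -/
theorem Submodule.exists_injectiveHull [Module.Injective A Q] (L : Submodule A Q) :
    ∃ D : Submodule A Q, L ≤ D ∧ Module.Injective A D ∧ ∀ N ≤ D, Disjoint L N → N = ⊥ := by
  -- C is a maximal submodule disjoint from L, and D ⊇ L is maximal disjoint from C. Then D is
  -- essential over L and Q/C is essential over the image of D, so the inclusion of D extends to an
  -- injective g on Q/C. Its range contains D and misses C, hence equals D, and q ↦ g(q mod C)
  -- retracts Q onto D.
  obtain ⟨C, -, hLC, hC⟩ := exists_maximal_disjoint (X := (⊥ : Submodule A Q)) (Y := L)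
    disjoint_bot_right
  obtain ⟨D, hLD, hCD, hD⟩ := exists_maximal_disjoint hLC.symm
  have hess : ∀ N ≤ D, Disjoint L N → N = ⊥ := fun N hN hLN ↦ by
    have hsup : Disjoint L (N ⊔ C) := by
      rw [Submodule.disjoint_def]
      intro m hm hmNC
      obtain ⟨x, hx, c, hc, rfl⟩ := Submodule.mem_sup.1 hmNC
      have hc0 : c = 0 := Submodule.disjoint_def.1 hCD c hc
        (by simpa using D.sub_mem (hLD hm) (hN hx))
      subst hc0
      rw [add_zero] at hm ⊢
      exact Submodule.disjoint_def.1 hLN x hm hx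
    have hNC : N ≤ C := by
      rw [← hC _ le_sup_right hsup]
      exact le_sup_left
    exact (Submodule.eq_bot_iff _).2 fun x hx ↦ Submodule.disjoint_def.1 hCD x (hNC hx) (hN hx)
  have hinj : Function.Injective (C.mkQ ∘ₗ D.subtype) := by
    refine (injective_iff_map_eq_zero _).2 fun d hd ↦ ?_
    exact Subtype.ext (Submodule.disjoint_def.1 hCD d
      ((Submodule.Quotient.mk_eq_zero C).1 hd) d.2)
  have hessQ : IsEssentialSubmodule (LinearMap.range (C.mkQ ∘ₗ D.subtype)) := by
    intro Y hY
    have : Y.comap C.mkQ = C := by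
      refine hC _ (fun c hc ↦ ?_) (Submodule.disjoint_def.2 fun m hm hmY ↦ ?_)
      · rw [Submodule.mem_comap, Submodule.mkQ_apply, (Submodule.Quotient.mk_eq_zero C).2 hc]
        exact Y.zero_mem
      · have : C.mkQ m ∈ LinearMap.range (C.mkQ ∘ₗ D.subtype) ⊓ Y := ⟨⟨⟨m, hLD hm⟩, rfl⟩, hmY⟩
        rw [hY, Submodule.mem_bot, Submodule.mkQ_apply, Submodule.Quotient.mk_eq_zero] at this
        exact Submodule.disjoint_def.1 hLC m hm this
    rw [Submodule.eq_bot_iff]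
    intro y hy
    obtain ⟨q, rfl⟩ := C.mkQ_surjective y
    have hq : q ∈ Y.comap C.mkQ := hy
    rw [this] at hq
    exact (Submodule.Quotient.mk_eq_zero C).2 hq
  obtain ⟨g, hg⟩ := Module.Injective.out (C.mkQ ∘ₗ D.subtype) hinj D.subtype
  have hginj : Function.Injective g := hessQ.injective_of_comp fun x y hxy ↦ by
    exact Subtype.ext (((hg x).symm.trans hxy).trans (hg y))
  have hrange : LinearMap.range g = D := by
    refine hD _ (fun d hd ↦ ⟨_, hg ⟨d, hd⟩⟩) (Submodule.disjoint_def.2 ?_)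
    rintro _ hx ⟨y, rfl⟩
    have : (C.comap g) = ⊥ := by
      refine hessQ _ ((Submodule.eq_bot_iff _).2 ?_)
      rintro _ ⟨⟨d, rfl⟩, hd⟩
      have hd0 := Submodule.disjoint_def.1 hCD (d : Q) (by rw [← D.subtype_apply, ← hg]; exact hd)
        d.2
      rw [show d = 0 from Subtype.ext hd0, map_zero]
    have hy : y ∈ C.comap g := hx
    rw [this, Submodule.mem_bot] at hy
    rw [hy, map_zero]
  refine ⟨D, hLD, ?_, hess⟩
  refine Module.Injective.of_retract D.subtype
    ((g ∘ₗ C.mkQ).codRestrict D fun q ↦ hrange ▸ ⟨C.mkQ q, rfl⟩) fun d ↦ Subtype.ext (hg d)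

theorem exists_injectiveHull [Module.Injective A Q] (j : M →ₗ[A] Q)
    (hj : Function.Injective j) :
    ∃ (E : Type u) (_ : AddCommGroup E) (_ : Module A E) (f : M →ₗ[A] E),
      Module.Injective A E ∧ Function.Injective f ∧ IsEssentialSubmodule (LinearMap.range f) := by
  obtain ⟨D, hLD, hD, hess⟩ := (LinearMap.range j).exists_injectiveHull
  refine ⟨D, inferInstance, inferInstance, j.codRestrict D fun m ↦ hLD ⟨m, rfl⟩, hD,
    fun x y h ↦ hj (congrArg Subtype.val h), fun N hN ↦ ?_⟩
  have : N.map D.subtype = ⊥ := by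
    refine hess _ (Submodule.map_subtype_le D N) (Submodule.disjoint_def.2 ?_)
    rintro _ ⟨m, hm⟩ ⟨n, hn, rfl⟩
    have : n ∈ LinearMap.range (j.codRestrict D fun m ↦ hLD ⟨m, rfl⟩) ⊓ N :=
      ⟨⟨m, Subtype.ext hm⟩, hn⟩
    rw [hN, Submodule.mem_bot] at this
    rw [this, map_zero]
  exact Submodule.map_injective_of_injective D.injective_subtype (this.trans (Submodule.map_bot _).symm)

/-- An injective hull `E` of a retract `M` of a submodule `K` of an injective module `Q` is a
retract of `Q`, compatibly. -/
theorem exists_retract_of_essential [Module.Injective A Q] [Module.Injective A E]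
    {K : Submodule A Q} (i : M →ₗ[A] K) (r : K →ₗ[A] M) (hri : ∀ m, r (i m) = m)
    (f : M →ₗ[A] E) (hf : Function.Injective f) (hess : IsEssentialSubmodule (LinearMap.range f)) :
    ∃ (i' : E →ₗ[A] Q) (r' : Q →ₗ[A] E), (∀ x, r' (i' x) = x) ∧ (∀ m, i' (f m) = i m) ∧
      ∀ k : K, r' k = f (r k) := by
  obtain ⟨i', hi'⟩ := Module.Injective.out f hf (K.subtype ∘ₗ i)
  obtain ⟨s, hs⟩ := Module.Injective.out K.subtype K.injective_subtype (f ∘ₗ r)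
  have hsi (m : M) : s (i' (f m)) = f m := by
    rw [hi']
    exact (hs (i m)).trans (by simp [hri])
  have hinj : Function.Injective (s ∘ₗ i') := hess.injective_of_comp fun x y hxy ↦ hf <| by
    simpa [hsi] using! hxy
  -- The map s ∘ i' fixes f(M) but perhaps not all of E. Its left inverse t corrects this and still
  -- fixes f(M).
  obtain ⟨t, ht⟩ := Module.Injective.out (s ∘ₗ i') hinj LinearMap.id
  refine ⟨i', t ∘ₗ s, ht, hi', fun k ↦ ?_⟩
  rw [LinearMap.comp_apply, ← K.subtype_apply, hs]
  calc t (f (r k)) = t (s (i' (f (r k)))) := by rw [hsi]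
    _ = f (r k) := ht _

end InjectiveHull

/-! ### Minimal injective resolutions as retracts -/

section Resolution

variable {A : Type u} [Ring A]

/-- The cochain complex underlying an exact sequence of modules. -/
noncomputable def cochainComplexOfExact (X : ℕ → ModuleCat.{u} A) (d : ∀ n, X n ⟶ X (n + 1))
    (hd : ∀ n, Function.Exact (d n) (d (n + 1))) : CochainComplex (ModuleCat.{u} A) ℕ :=
  CochainComplex.of X d fun n ↦ by
    ext x
    exact (hd n).apply_apply_eq_zero x

lemma cochainComplexOfExact_d (X : ℕ → ModuleCat.{u} A) (d : ∀ n, X n ⟶ X (n + 1))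
    (hd : ∀ n, Function.Exact (d n) (d (n + 1))) (n : ℕ) :
    (cochainComplexOfExact X d hd).d n (n + 1) = d n :=
  CochainComplex.of_d X d n

/-- An injective resolution from an exact sequence `0 → M → X 0 → X 1 → ⋯` of injectives. -/
noncomputable def injectiveResolutionOfExact {M : ModuleCat.{u} A} (X : ℕ → ModuleCat.{u} A)
    (hX : ∀ n, Injective (X n)) (d : ∀ n, X n ⟶ X (n + 1)) (η : M ⟶ X 0)
    (hη : Function.Injective η) (hηd : Function.Exact η (d 0))
    (hd : ∀ n, Function.Exact (d n) (d (n + 1))) : InjectiveResolution M :=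
  have hzero : η ≫ (cochainComplexOfExact X d hd).d 0 1 = 0 :=
    (congrArg (η ≫ ·) (cochainComplexOfExact_d X d hd 0)).trans <| by
      ext x
      exact hηd.apply_apply_eq_zero x
  { cocomplex := cochainComplexOfExact X d hd
    injective := hX
    ι := (CochainComplex.fromSingle₀Equiv _ _).symm ⟨η, hzero⟩
    quasiIso := ⟨fun n ↦ by
      cases n with
      | zero =>
        rw [CochainComplex.quasiIsoAt₀_iff, ShortComplex.quasiIso_iff_of_zeros]
        · refine (ShortComplex.exact_and_mono_f_iff_of_iso (S₂ := ShortComplex.mk η (d 0)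
            (by ext x; exact hηd.apply_apply_eq_zero x)) ?_).2
            ⟨(ShortComplex.ShortExact.moduleCat_exact_iff_function_exact _).2 hηd,
              (ModuleCat.mono_iff_injective _).2 hη⟩
          exact ShortComplex.isoMk (Iso.refl _) (Iso.refl _) (Iso.refl _)
            ((Category.id_comp _).trans (Category.comp_id _).symm)
            ((Category.id_comp _).trans ((cochainComplexOfExact_d X d hd 0).symm.trans
              (Category.comp_id _).symm))
        all_goals rfl
      | succ n =>
        rw [quasiIsoAt_iff_exactAt]
        · rw [HomologicalComplex.exactAt_iff' _ n (n + 1) (n + 1 + 1) (by simp) (by simp),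
            ShortComplex.ShortExact.moduleCat_exact_iff_function_exact]
          have h := hd n
          rw [← cochainComplexOfExact_d X d hd n, ← cochainComplexOfExact_d X d hd (n + 1)] at h
          exact h
        · apply CochainComplex.exactAt_succ_single_obj⟩ }

lemma isMinimalInjectiveResolution_ofExact {M : ModuleCat.{u} A} (X : ℕ → ModuleCat.{u} A)
    (hX : ∀ n, Injective (X n)) (d : ∀ n, X n ⟶ X (n + 1)) (η : M ⟶ X 0)
    (hη : Function.Injective η) (hηd : Function.Exact η (d 0))
    (hd : ∀ n, Function.Exact (d n) (d (n + 1)))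
    (h : ∀ n, IsEssentialSubmodule (LinearMap.ker (d n).hom)) :
    IsMinimalInjectiveResolution (injectiveResolutionOfExact X hX d η hη hηd hd) := fun n N hN ↦
  h n N <| (congrArg (fun g : X n ⟶ X (n + 1) ↦ LinearMap.ker g.hom ⊓ (N : Submodule A (X n)))
    (cochainComplexOfExact_d X d hd n).symm).trans hN

/-- A retract `M` of the kernel of `J 0 → J 1`, where `J 0 → J 1 → ⋯` is an exact sequence of
injectives, has a minimal injective resolution that is a degreewise retract of `J`. -/
theorem exists_minimalInjectiveResolution_retract {M : Type u} [AddCommGroup M] [Module A M]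
    (J : ℕ → ModuleCat.{u} A) (hJ : ∀ n, Module.Injective A (J n))
    (d : ∀ n, J n →ₗ[A] J (n + 1)) (hd : ∀ n, Function.Exact (d n) (d (n + 1)))
    (i₀ : M →ₗ[A] LinearMap.ker (d 0)) (r₀ : LinearMap.ker (d 0) →ₗ[A] M)
    (h₀ : ∀ m, r₀ (i₀ m) = m) :
    ∃ I : InjectiveResolution (ModuleCat.of A M), IsMinimalInjectiveResolution I ∧
      ∀ n, ∃ (i : I.cocomplex.X n →ₗ[A] J n) (r : J n →ₗ[A] I.cocomplex.X n),
        ∀ x, r (i x) = x := by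
  -- A state is the n-th cosyzygy with its retraction from ker(d n). The compatible retraction of J
  -- n onto its hull E passes to quotients, and J n / ker(d n) ≅ ker(d (n + 1)) by exactness, which
  -- gives the next state.
  let State (n : ℕ) := {M : ModuleCat.{u} A // ∃ (i : M →ₗ[A] LinearMap.ker (d n))
    (r : LinearMap.ker (d n) →ₗ[A] M), ∀ m, r (i m) = m}
  have step (n : ℕ) (S : State n) : ∃ (E : ModuleCat.{u} A) (f : S.1 →ₗ[A] E),
      Module.Injective A E ∧ Function.Injective f ∧ IsEssentialSubmodule (LinearMap.range f) ∧
      (∃ (i : E →ₗ[A] J n) (r : J n →ₗ[A] E), ∀ x, r (i x) = x) ∧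
      ∃ (i : (E ⧸ LinearMap.range f) →ₗ[A] LinearMap.ker (d (n + 1)))
        (r : LinearMap.ker (d (n + 1)) →ₗ[A] (E ⧸ LinearMap.range f)), ∀ x, r (i x) = x := by
    obtain ⟨M, i, r, hri⟩ := S
    have := hJ n
    obtain ⟨E, _, _, f, hE, hf, hess⟩ := exists_injectiveHull (Q := J n)
      ((LinearMap.ker (d n)).subtype ∘ₗ i) ((LinearMap.ker (d n)).injective_subtype.comp
        (Function.LeftInverse.injective hri))
    obtain ⟨i', r', h, hi, hr⟩ := exists_retract_of_essential i r hri f hf hess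
    refine ⟨ModuleCat.of A E, f, hE, hf, hess, ⟨i', r', h⟩, ?_⟩
    let e : (J n ⧸ LinearMap.ker (d n)) ≃ₗ[A] LinearMap.ker (d (n + 1)) :=
      (d n).quotKerEquivRange ≪≫ₗ LinearEquiv.ofEq _ _ (LinearMap.exact_iff.1 (hd n)).symm
    refine ⟨e.toLinearMap ∘ₗ Submodule.mapQ (LinearMap.range f) (LinearMap.ker (d n)) i' ?_,
      Submodule.mapQ (LinearMap.ker (d n)) (LinearMap.range f) r' ?_ ∘ₗ e.symm.toLinearMap, ?_⟩
    · rintro _ ⟨m, rfl⟩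
      rw [Submodule.mem_comap, hi]
      exact (i m).2
    · intro x hx
      exact ⟨r ⟨x, hx⟩, (hr ⟨x, hx⟩).symm⟩
    · intro x
      obtain ⟨x, rfl⟩ := Submodule.mkQ_surjective _ x
      simp only [LinearMap.comp_apply, LinearEquiv.coe_coe, e.symm_apply_apply, Submodule.mapQ_apply,
        Submodule.mkQ_apply]
      exact congrArg Submodule.Quotient.mk (h x)
  choose E f hE hf hess hEJ hquot using step
  let S (n : ℕ) : State n := Nat.rec ⟨ModuleCat.of A M, i₀, r₀, h₀⟩
    (fun n s ↦ ⟨ModuleCat.of A (E n s ⧸ LinearMap.range (f n s)), hquot n s⟩) n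
  let δ (n : ℕ) : E n (S n) →ₗ[A] E (n + 1) (S (n + 1)) :=
    f (n + 1) (S (n + 1)) ∘ₗ (LinearMap.range (f n (S n))).mkQ
  have hker (n : ℕ) : LinearMap.ker (δ n) = LinearMap.range (f n (S n)) := by
    rw [LinearMap.ker_comp_of_ker_eq_bot _ (LinearMap.ker_eq_bot.2 (hf _ _)), Submodule.ker_mkQ]
  have hrange (n : ℕ) : LinearMap.range (δ n) = LinearMap.range (f (n + 1) (S (n + 1))) :=
    LinearMap.range_comp_of_range_eq_top _ (Submodule.range_mkQ _)
  refine ⟨injectiveResolutionOfExact (fun n ↦ E n (S n))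
    (fun n ↦ (Module.injective_iff_injective_object _ _).1 (hE _ _)) (fun n ↦ ModuleCat.ofHom (δ n))
    (ModuleCat.ofHom (f 0 (S 0))) (hf _ _) (LinearMap.exact_iff.2 (hker 0))
    (fun n ↦ LinearMap.exact_iff.2 ((hker _).trans (hrange n).symm)),
    isMinimalInjectiveResolution_ofExact _ _ _ _ _ _ _ fun n ↦ ?_, fun n ↦ hEJ n (S n)⟩
  change IsEssentialSubmodule (LinearMap.ker (δ n))
  rw [hker]
  exact hess n (S n)

/-- A ring `A` is `k`-Gorenstein if it is a retract of a module `N` with an injective resolution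
`J` such that `fd (J n) ≤ n` for `n < k`. -/
theorem isKGorenstein_of_exact {N : Type u} [AddCommGroup N] [Module A N]
    (J : ℕ → ModuleCat.{u} A) (hJ : ∀ n, Module.Injective A (J n))
    (d : ∀ n, J n →ₗ[A] J (n + 1)) (hd : ∀ n, Function.Exact (d n) (d (n + 1)))
    (η : N →ₗ[A] J 0) (hη : Function.Injective η) (hηd : Function.Exact η (d 0))
    (i : A →ₗ[A] N) (r : N →ₗ[A] A) (h : ∀ m, r (i m) = m) {k : ℕ}
    (hk : ∀ n < k, FlatDimensionLE A n (J n)) : IsKGorenstein A k := by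
  let e : N ≃ₗ[A] LinearMap.ker (d 0) :=
    LinearEquiv.ofInjective η hη ≪≫ₗ LinearEquiv.ofEq _ _ (LinearMap.exact_iff.1 hηd).symm
  obtain ⟨I, hI, hret⟩ := exists_minimalInjectiveResolution_retract J hJ d hd
    (e.toLinearMap ∘ₗ i) (r ∘ₗ e.symm.toLinearMap) fun m ↦ by simp [h]
  refine ⟨I, hI, fun n hn ↦ ?_⟩
  obtain ⟨i, r, h⟩ := hret n
  exact (hk n hn).of_retract i r h

/-- The exact sequence of injectives underlying the resolution of a `k`-Gorenstein ring. -/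
theorem IsKGorenstein.exists_exact {k : ℕ} (h : IsKGorenstein A k) :
    ∃ (J : ℕ → ModuleCat.{u} A) (d : ∀ n, J n →ₗ[A] J (n + 1)) (η : A →ₗ[A] J 0),
      (∀ n, Module.Injective A (J n)) ∧ (∀ n, Function.Exact (d n) (d (n + 1))) ∧
      Function.Injective η ∧ Function.Exact η (d 0) ∧ ∀ n < k, FlatDimensionLE A n (J n) := by
  obtain ⟨I, -, hfd⟩ := h
  refine ⟨fun n ↦ I.cocomplex.X n, fun n ↦ (I.cocomplex.d n (n + 1)).hom, (I.ι.f 0).hom,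
    fun n ↦ (Module.injective_iff_injective_object _ _).2 (I.injective n), fun n ↦
    (ShortComplex.ShortExact.moduleCat_exact_iff_function_exact _).1 (I.exact_succ n),
    (ModuleCat.mono_iff_injective _).1 (inferInstanceAs (Mono (I.ι.f 0))),
    (ShortComplex.ShortExact.moduleCat_exact_iff_function_exact _).1 I.exact₀, hfd⟩

end Resolution

/-! ### Restriction and extension of scalars along R → A -/

section BaseChange

variable {R A : Type u} [CommRing R] [Ring A] [Algebra R A]

/-- Injective modules over a flat algebra are injective over the base ring. -/
theorem Module.Injective.of_flat_algebra [Module.Flat R A] (E : Type u) [AddCommGroup E]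
    [Module R E] [Module A E] [IsScalarTower R A E] [Module.Injective A E] :
    Module.Injective R E where
  out X Y _ _ _ _ f hf g := by
    -- Hom_R(X, E) = Hom_A(A ⊗ X, E), and A ⊗ - preserves injections.
    let G : A ⊗[R] X →ₗ[A] E :=
      TensorProduct.AlgebraTensorModule.lift (LinearMap.toSpanSingleton A (X →ₗ[R] E) g)
    obtain ⟨H, hH⟩ := Module.Injective.out (f.baseChange A)
      (Module.Flat.lTensor_preserves_injective_linearMap f hf) G
    refine ⟨H.restrictScalars R ∘ₗ TensorProduct.mk R A Y 1, fun x ↦ ?_⟩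
    have := hH (1 ⊗ₜ x)
    simpa [G] using this

/-- By Lambek's criterion this is the preceding result for F⁺ over the flat R-algebra Aᵐᵒᵖ,
transported along R ≅ Rᵐᵒᵖ. -/
theorem IsFlatModule.of_flat_algebra [Module.Flat R A] {F : Type u} [AddCommGroup F]
    [Module R F] [Module A F] [IsScalarTower R A F] (hF : IsFlatModule A F) :
    IsFlatModule R F := by
  rw [isFlatModule_iff_injective] at hF ⊢
  have : Module.Flat R Aᵐᵒᵖ := .of_linearEquiv (MulOpposite.opLinearEquiv R).symm
  let : Module R (RightCharacterModule F) :=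
    Module.compHom _ (algebraMap R Aᵐᵒᵖ)
  have : IsScalarTower R Aᵐᵒᵖ (RightCharacterModule F) := .of_algebraMap_smul fun _ _ ↦ rfl
  have := Module.Injective.of_flat_algebra (R := R) (A := Aᵐᵒᵖ) (RightCharacterModule F)
  have := RingHomInvPair.of_ringEquiv (RingEquiv.toOpposite R)
  have := RingHomInvPair.of_ringEquiv (RingEquiv.toOpposite R).symm
  exact Module.Injective.of_ringEquiv (R := R) (M := RightCharacterModule F)
    (RingEquiv.toOpposite R)
    { AddEquiv.refl (RightCharacterModule F) with
      map_smul' := fun r c ↦ RightCharacterModule.ext fun m ↦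
        congrArg c (algebraMap_smul A r m) }

/-- Restriction of scalars along a flat algebra does not increase flat dimensions. -/
theorem FlatDimensionLE.of_flat_algebra [Module.Flat R A] (n : ℕ) :
    ∀ (M : Type u) [AddCommGroup M] [Module R M] [Module A M] [IsScalarTower R A M],
      FlatDimensionLE A n M → FlatDimensionLE R n M := by
  induction n with
  | zero => exact fun M _ _ _ _ h ↦ IsFlatModule.of_flat_algebra h
  | succ n ih =>
    rintro M _ _ _ _ ⟨F, _, _, p, hF, hp, hK⟩
    let : Module R F := Module.compHom F (algebraMap R A)
    have : IsScalarTower R A F := .of_algebraMap_smul fun _ _ ↦ rfl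
    refine ⟨F, inferInstance, inferInstance, p.restrictScalars R,
      IsFlatModule.of_flat_algebra hF, hp, ?_⟩
    exact (ih _ hK).of_linearEquiv
      { toFun := fun x ↦ ⟨x.1, x.2⟩
        invFun := fun x ↦ ⟨x.1, x.2⟩
        map_add' := fun _ _ ↦ rfl
        map_smul' := fun _ _ ↦ rfl }

/-- Flatness is preserved by base change to an algebra. -/
theorem IsFlatModule.baseChange {F : Type u} [AddCommGroup F] [Module R F]
    (hF : IsFlatModule R F) : IsFlatModule A (A ⊗[R] F) := by
  rw [isFlatModule_iff_injective] at hF ⊢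
  refine ⟨fun N N' _ _ _ _ f hf g ↦ ?_⟩
  let : Module Rᵐᵒᵖ N := Module.compHom N (algebraMap R A).op
  let : Module Rᵐᵒᵖ N' := Module.compHom N' (algebraMap R A).op
  have smul_def (r : Rᵐᵒᵖ) (n : N') : r • n = MulOpposite.op (algebraMap R A r.unop) • n := rfl
  let f₀ : N →ₗ[Rᵐᵒᵖ] N' := { f with map_smul' := fun r n ↦ f.map_smul _ n }
  -- Maps N → (A ⊗ F)⁺ over Aᵐᵒᵖ correspond to maps N → F⁺ over Rᵐᵒᵖ: restrict characters to 1 ⊗ F,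
  -- and return by a ⊗ m ↦ h(n a)(m).
  let g₀ : N →ₗ[Rᵐᵒᵖ] RightCharacterModule F :=
    { toFun := fun n ↦ .of ((g n : A ⊗[R] F →+ AddCircle (1 : ℚ)).comp
        (TensorProduct.mk R A F 1).toAddMonoidHom)
      map_add' := fun n n' ↦ RightCharacterModule.ext fun m ↦
        DFunLike.congr_fun (g.map_add n n') (1 ⊗ₜ m)
      map_smul' := fun r n ↦ RightCharacterModule.ext fun m ↦ by
        have := DFunLike.congr_fun (g.map_smul (MulOpposite.op (algebraMap R A r.unop)) n)
          ((1 : A) ⊗ₜ[R] m)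
        refine this.trans (congrArg (g n) ?_)
        simp }
  obtain ⟨h, hh⟩ := Module.Injective.out f₀ hf g₀
  let h' (n : N') : RightCharacterModule (A ⊗[R] F) := .of <| TensorProduct.liftAddHom
    { toFun := fun a ↦ (h (MulOpposite.op a • n) : F →+ AddCircle (1 : ℚ))
      map_zero' := by
        rw [MulOpposite.op_zero, zero_smul]
        exact map_zero h
      map_add' := fun a b ↦ by
        rw [MulOpposite.op_add, add_smul]
        exact map_add h _ _ }
    fun r a m ↦ by
      change h (MulOpposite.op (r • a) • n) m = h (MulOpposite.op a • n) (r • m)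
      have := DFunLike.congr_fun (h.map_smul (MulOpposite.op r) (MulOpposite.op a • n)) m
      rw [smul_def, smul_smul, MulOpposite.unop_op, ← MulOpposite.op_mul,
        ← Algebra.commutes, ← Algebra.smul_def] at this
      exact this
  have h'_tmul (n : N') (a : A) (m : F) : h' n (a ⊗ₜ m) = h (MulOpposite.op a • n) m := rfl
  have ext {c c' : RightCharacterModule (A ⊗[R] F)}
      (H : ∀ a m, c (a ⊗ₜ m) = c' (a ⊗ₜ m)) : c = c' := by
    refine RightCharacterModule.ext fun z ↦ ?_
    induction z with
    | zero => rw [map_zero, map_zero]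
    | tmul a m => exact H a m
    | add x y hx hy => rw [map_add, map_add, hx, hy]
  refine ⟨{ toFun := h', map_add' := fun n n' ↦ ext fun a m ↦ ?_,
            map_smul' := fun c n ↦ ext fun a m ↦ ?_ }, fun n ↦ ext fun a m ↦ ?_⟩
  · rw [RightCharacterModule.add_apply, h'_tmul, h'_tmul, h'_tmul, smul_add, map_add,
      RightCharacterModule.add_apply]
  · rw [RingHom.id_apply, RightCharacterModule.smul_apply, TensorProduct.smul_tmul', h'_tmul,
      h'_tmul, smul_smul]
    rfl
  · change h (MulOpposite.op a • f n) m = _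
    rw [← map_smul f]
    refine (DFunLike.congr_fun (hh _) m).trans ?_
    change g (MulOpposite.op a • n) (1 ⊗ₜ m) = _
    rw [map_smul, RightCharacterModule.smul_apply, TensorProduct.smul_tmul']
    simp

/-- Base change to a flat algebra does not increase flat dimensions. -/
theorem FlatDimensionLE.baseChange [Module.Flat R A] (n : ℕ) :
    ∀ (M : Type u) [AddCommGroup M] [Module R M],
      FlatDimensionLE R n M → FlatDimensionLE A n (A ⊗[R] M) := by
  induction n with
  | zero => exact fun M _ _ h ↦ IsFlatModule.baseChange h
  | succ n ih =>
    rintro M _ _ ⟨F, _, _, p, hF, hp, hK⟩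
    refine ⟨A ⊗[R] F, inferInstance, inferInstance, p.baseChange A, hF.baseChange,
      LinearMap.lTensor_surjective A hp, (ih _ hK).of_linearEquiv (LinearEquiv.symm ?_)⟩
    have hex : Function.Exact ((LinearMap.ker p).subtype.baseChange A) (p.baseChange A) :=
      lTensor_exact A (LinearMap.exact_subtype_ker_map p) hp
    exact LinearEquiv.ofInjective ((LinearMap.ker p).subtype.baseChange A)
      (Module.Flat.lTensor_preserves_injective_linearMap _ (LinearMap.ker p).injective_subtype)
      ≪≫ₗ LinearEquiv.ofEq _ _ (LinearMap.exact_iff.1 hex).symm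

end BaseChange

/-! ### Frobenius systems and transfer of the Gorenstein condition -/

section Frobenius

variable {R A : Type u} [CommRing R] [Ring A] [Algebra R A]

lemma Module.exists_dualBasis (R M : Type*) [CommRing R] [AddCommGroup M] [Module R M]
    [Module.Finite R M] [Module.Projective R M] :
    ∃ (n : ℕ) (a : Fin n → M) (f : Fin n → M →ₗ[R] R), ∀ x, ∑ i, f i x • a i = x := by
  obtain ⟨n, p, s, -, -, hps⟩ := Module.Finite.exists_comp_eq_id_of_projective R M
  refine ⟨n, fun i ↦ p (Pi.single i 1), fun i ↦ LinearMap.proj i ∘ₗ s, fun x ↦ ?_⟩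
  calc ∑ i, (LinearMap.proj i ∘ₗ s) x • p (Pi.single i 1)
      = p (∑ i, s x i • Pi.single i 1) := by simp [map_sum]
    _ = p (s x) := by rw [← pi_eq_sum_univ' (s x)]
    _ = x := LinearMap.congr_fun hps x

/-- A linear form `ε` on `A` with dual bases `a`, `b`: the data exhibiting `A` as a Frobenius
algebra over `R`. -/
structure FrobeniusSystem (R A : Type*) [CommRing R] [Ring A] [Algebra R A] where
  /-- the linear form -/
  ε : A →ₗ[R] R
  /-- the size of the dual bases -/
  n : ℕ
  /-- the first basis -/
  a : Fin n → A
  /-- the second basis -/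
  b : Fin n → A
  sum_a (x : A) : ∑ i, ε (x * b i) • a i = x
  sum_b (x : A) : ∑ i, ε (a i * x) • b i = x

/-- Take ε = e 1, so that e b x = ε(x b), and let the b i correspond under e to the coordinate forms
of a dual basis. The second identity is checked after applying the injective map e. -/
lemma exists_frobeniusSystem [Module.Finite R A] [Module.Projective R A]
    (e : A ≃+ (A →ₗ[R] R)) (he : ∀ b a x : A, e (b * a) x = e a (x * b)) :
    Nonempty (FrobeniusSystem R A) := by
  obtain ⟨n, a, f, h⟩ := Module.exists_dualBasis R A
  have he1 (b x : A) : e b x = e 1 (x * b) := by rw [← he, mul_one]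
  have hb (x : A) (i : Fin n) : e 1 (x * e.symm (f i)) = f i x := by
    rw [← he1, e.apply_symm_apply]
  refine ⟨⟨e 1, n, a, fun i ↦ e.symm (f i), fun x ↦ by simp_rw [hb, h], fun x ↦ ?_⟩⟩
  refine e.injective (LinearMap.ext fun y ↦ ?_)
  rw [he1, he1 x, Finset.mul_sum, map_sum]
  calc ∑ i, e 1 (y * e 1 (a i * x) • e.symm (f i))
      = ∑ i, f i y * e 1 (a i * x) := Finset.sum_congr rfl fun i _ ↦ by
        rw [mul_smul_comm, map_smul, hb, smul_eq_mul, mul_comm]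
    _ = e 1 ((∑ i, f i y • a i) * x) := by simp [Finset.sum_mul, map_sum]
    _ = e 1 (y * x) := by rw [h]

/-- The Casimir element ∑ b i ⊗ a i commutes with A: expand c * b i in the b j, then resum the a i.
This yields A-linearity of the extension built in `injective_baseChange`. -/
lemma FrobeniusSystem.casimir (S : FrobeniusSystem R A) {P : Type*} [AddCommGroup P] [Module R P]
    (β : A →ₗ[R] A →ₗ[R] P) (c : A) :
    ∑ i, β (c * S.b i) (S.a i) = ∑ i, β (S.b i) (S.a i * c) := by
  calc ∑ i, β (c * S.b i) (S.a i)
      = ∑ i, ∑ j, S.ε (S.a j * (c * S.b i)) • β (S.b j) (S.a i) :=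
        Finset.sum_congr rfl fun i _ ↦ by
          conv_lhs => rw [← S.sum_b (c * S.b i)]
          simp
    _ = ∑ j, β (S.b j) (∑ i, S.ε (S.a j * c * S.b i) • S.a i) := by
        rw [Finset.sum_comm]
        simp [mul_assoc]
    _ = _ := by simp_rw [S.sum_a]

/-- Base change to a Frobenius algebra preserves injective modules. -/
theorem FrobeniusSystem.injective_baseChange (S : FrobeniusSystem R A) (Q : Type u)
    [AddCommGroup Q] [Module R Q] [Module.Injective R Q] : Module.Injective A (A ⊗[R] Q) where
  out X Y _ _ _ _ f hf g := by
    let : Module R X := Module.compHom X (algebraMap R A)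
    let : Module R Y := Module.compHom Y (algebraMap R A)
    have : IsScalarTower R A X := .of_algebraMap_smul fun _ _ ↦ rfl
    have : IsScalarTower R A Y := .of_algebraMap_smul fun _ _ ↦ rfl
    -- An A-linear map into A ⊗ Q is recovered from its composite with p = ε ⊗ Q through z = ∑ b i ⊗
    -- p(a i z), so it is enough to extend p ∘ g over R.
    let p : A ⊗[R] Q →ₗ[R] Q := TensorProduct.lid R Q ∘ₗ S.ε.rTensor Q
    obtain ⟨h, hh⟩ := Module.Injective.out (f.restrictScalars R) hf (p ∘ₗ g.restrictScalars R)
    refine ⟨{ toFun := fun y ↦ ∑ i, S.b i ⊗ₜ h (S.a i • y),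
              map_add' := fun y z ↦ ?_, map_smul' := fun c y ↦ ?_ }, fun x ↦ ?_⟩
    · simp [TensorProduct.tmul_add, Finset.sum_add_distrib]
    · let β : A →ₗ[R] A →ₗ[R] A ⊗[R] Q := (TensorProduct.mk R A Q).compl₂
        (h ∘ₗ (LinearMap.toSpanSingleton A Y y).restrictScalars R)
      have := S.casimir β c
      simpa [β, Finset.smul_sum, TensorProduct.smul_tmul', mul_smul] using this.symm
    · have key (z : A ⊗[R] Q) : ∑ i, S.b i ⊗ₜ[R] p (S.a i • z) = z := by
        induction z with
        | zero => simp
        | tmul c m =>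
          simp only [p, TensorProduct.smul_tmul', LinearMap.comp_apply, LinearEquiv.coe_coe,
            LinearMap.rTensor_tmul, TensorProduct.lid_tmul, smul_eq_mul,
            ← TensorProduct.smul_tmul, ← TensorProduct.sum_tmul, S.sum_b]
        | add x y hx hy =>
          simp only [smul_add, map_add, TensorProduct.tmul_add, Finset.sum_add_distrib, hx, hy]
      refine Eq.trans ?_ (key (g x))
      change ∑ i, S.b i ⊗ₜ[R] h (S.a i • f x) = _
      refine Finset.sum_congr rfl fun i _ ↦ ?_
      rw [← map_smul f, ← map_smul g]
      exact congrArg _ (hh _)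

/-- The base ring is a retract of a finitely generated projective faithfully flat algebra. -/
lemma exists_linearMap_one_eq_one [Module.Finite R A] [Module.Projective R A]
    (hA : ∀ I : Ideal R, I • (⊤ : Submodule R A) = ⊤ → I = ⊤) :
    ∃ t : A →ₗ[R] R, t 1 = 1 := by
  obtain ⟨n, a, f, h⟩ := Module.exists_dualBasis R A
  -- The ideal of all values t(1) satisfies I A = A, because x = ∑ f i(1) a i x.
  have := hA (LinearMap.range (LinearMap.applyₗ (R := R) (M₂ := R) (1 : A))) <| by
    refine eq_top_iff.2 fun x _ ↦ ?_
    have hx : ∑ i, f i 1 • a i * x = x := by rw [← Finset.sum_mul, h, one_mul]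
    rw [← hx]
    refine Submodule.sum_mem _ fun i _ ↦ ?_
    rw [smul_mul_assoc]
    exact Submodule.smul_mem_smul ⟨f i, rfl⟩ trivial
  exact (Ideal.eq_top_iff_one _).1 this

theorem FrobeniusSystem.isKGorenstein [Module.Flat R A] (S : FrobeniusSystem R A) {k : ℕ}
    (h : IsKGorenstein R k) : IsKGorenstein A k := by
  obtain ⟨J, d, η, hJ, hd, hη, hηd, hfd⟩ := h.exists_exact
  have := hJ
  refine isKGorenstein_of_exact (N := A ⊗[R] R) (fun n ↦ ModuleCat.of A (A ⊗[R] J n))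
    (fun n ↦ S.injective_baseChange (J n)) (fun n ↦ (d n).baseChange A)
    (fun n ↦ Module.Flat.lTensor_exact A (hd n)) (η.baseChange A)
    (Module.Flat.lTensor_preserves_injective_linearMap η hη) (Module.Flat.lTensor_exact A hηd)
    (TensorProduct.AlgebraTensorModule.rid R A A).symm.toLinearMap
    (TensorProduct.AlgebraTensorModule.rid R A A).toLinearMap
    (LinearEquiv.apply_symm_apply _) fun n hn ↦ (hfd n hn).baseChange n

/-- Restricted to R, the resolution of A resolves A as an R-module, of which R is a retract through
t. -/
theorem isKGorenstein_of_retract_of_flat [Module.Flat R A] (t : A →ₗ[R] R) (ht : t 1 = 1) {k : ℕ}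
    (h : IsKGorenstein A k) : IsKGorenstein R k := by
  obtain ⟨J, d, η, hJ, hd, hη, hηd, hfd⟩ := h.exists_exact
  let (n : ℕ) : Module R (J n) := Module.compHom (J n) (algebraMap R A)
  have (n : ℕ) : IsScalarTower R A (J n) := .of_algebraMap_smul fun _ _ ↦ rfl
  have := hJ
  refine isKGorenstein_of_exact (N := A) (fun n ↦ ModuleCat.of R (J n))
    (fun n ↦ .of_flat_algebra (A := A) (J n)) (fun n ↦ (d n).restrictScalars R) hd
    (η.restrictScalars R) hη hηd (Algebra.linearMap R A) t (fun r ↦ ?_)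
    fun n hn ↦ .of_flat_algebra n _ (hfd n hn)
  rw [Algebra.linearMap_apply, Algebra.algebraMap_eq_smul_one, map_smul, ht, smul_eq_mul, mul_one]

end Frobenius

theorem proposition5p17 {R A : Type u} [CommRing R] [IsNoetherianRing R] [Ring A]
    (φ : R →+* A) (hcentral : ∀ r : R, φ r ∈ Subring.center A)
    (hfrob : IsFrobeniusExtension φ)
    (hff : letI := rightModuleAlong φ; Module.FaithfullyFlat Rᵐᵒᵖ A)
    (k : ℕ) (hk : 0 < k) :
    IsKGorenstein R k ↔ IsKGorenstein A k := by
  let : Algebra R A := φ.toAlgebra' fun r x ↦ ((Subring.mem_center_iff.1 (hcentral r)) x).symm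
  obtain ⟨hfin, hproj, e, he, -⟩ := hfrob
  have hmod : (leftModuleAlong φ : Module R A) = Algebra.toModule := rfl
  rw [hmod] at hfin hproj
  obtain ⟨S⟩ := exists_frobeniusSystem (R := R) (A := A) e he
  -- Centrality makes the left and right R-actions agree, so I A = A can be read over Rᵐᵒᵖ, where
  -- faithful flatness is given.
  have hA (I : Ideal R) (hI : I • (⊤ : Submodule R A) = ⊤) : I = ⊤ := by
    let := rightModuleAlong φ
    have := ((Module.FaithfullyFlat.iff_flat_and_ideal_smul_eq_top Rᵐᵒᵖ A).1 hff).2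
      (I.comap (RingEquiv.toOpposite R).symm) <| by
      refine eq_top_iff.2 fun x _ ↦ ?_
      have hx : x ∈ I • (⊤ : Submodule R A) := by rw [hI]; trivial
      induction hx using Submodule.smul_induction_on' with
      | smul r hr a _ =>
        have : r • a = MulOpposite.op r • a := Algebra.commutes r a
        rw [this]
        exact Submodule.smul_mem_smul (I := I.comap (RingEquiv.toOpposite R).symm) hr trivial
      | add x _ y _ hx hy => exact add_mem (hx trivial) (hy trivial)
    rw [Ideal.eq_top_iff_one] at this ⊢
    exact this
  obtain ⟨t, ht⟩ := exists_linearMap_one_eq_one hA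
  exact ⟨S.isKGorenstein, isKGorenstein_of_retract_of_flat t ht⟩
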